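/- Let $\{p_n\}_{n\ge 0}$ be a sequence of positive numbers with $p_0=1$, decreasing monotonically to $0$, and let $\mathcal B=\bigcup_{n\ge 0}[n,n+1]\times[0,p_n]$ be the corresponding infinite step billiard table. For $\vartheta\in\,]0,\pi/2[$ let $S(\vartheta)$ be the invariant surface of the billiard flow with velocities $(\pm\cos\vartheta,\pm\sin\vartheta)$. It is obtained by unfolding from the region $\{(X,Y):(|X|,|Y|)\in\mathcal B\}$ by the side identifications $(X,p_n)\sim(X,-p_n)$ for $n\le|X|\le n+1$ and $(k,Y)\sim(-k,Y)$ for $k\ge1$, $p_k\le|Y|\le p_{k-1}$, and the flow on it moves at unit speed in the direction $(\cos\vartheta,\sin\vartheta)$. Trajectories that hit a vertex $(k,\pm p_k)$ are continued by continuity from above, so that every trajectory is defined for all times $t\in\mathbb R$: one arriving from the left at $(k,Y)$, $k\ge 1$, passes to the right if $Y\in[-p_k,p_k[$, and hits a vertical side otherwise. An orbit on $S(\vartheta)$ is called an escape orbit if, from some time on, it never collides with a vertical side and if its $X$-coordinate tends to $+\infty$ as $t\to+\infty$. Let $L=\{0\}\times[-1,1[$ be the curve on $S(\vartheta)$ that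 corresponds to the first vertical side. For $n\ge1$ let $E^{(n)}_\vartheta\subset L$ be the set of points whose forward orbit reaches the aperture $\{n\}\times[-p_n,p_n[$ without colliding with any vertical side after leaving $L$, and put $E_\vartheta=\bigcap_{n\ge1}E^{(n)}_\vartheta$. Suppose that $p_{n+1}\le\lambda p_n$ for all $n\ge0$, where $0<\lambda<\lambda_0:=\frac{\sqrt6-1}{5}$. Then for Lebesgue-almost every $\vartheta\in\,]0,\pi/2[$ there is exactly one escape orbit on $S(\vartheta)$, and $E_\vartheta$ consists of exactly one point. -/

import Mathlib

/-- An infinite step billiard: the table is the union over `n` of the boxes `[n, n+1] × [0, p n]`,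
where the heights `p n > 0` decrease monotonically to `0` and `p 0 = 1`. -/
structure StepBilliard where
  /-- The heights of the steps. -/
  p : ℕ → ℝ
  p_zero : p 0 = 1
  p_pos : ∀ n, 0 < p n
  p_antitone : Antitone p
  p_tendsto : Filter.Tendsto p Filter.atTop (nhds 0)

namespace StepBilliard

/-- The billiard table. -/
def table (P : StepBilliard) : Set (ℝ × ℝ) :=
  ⋃ n : ℕ, Set.Icc (n : ℝ) ((n : ℝ) + 1) ×ˢ Set.Icc 0 (P.p n)

/-- Half of the vertical size of the unfolded table above `[n, n+1]`, for an integer `n`: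
it is `p n` for `n ≥ 0`, and `p m` for `n = -(m+1) < 0`. -/
def halfWidth (P : StepBilliard) (n : ℤ) : ℝ :=
  if 0 ≤ n then P.p n.toNat else P.p (-n - 1).toNat

/-- The invariant surface. Unfolding along the two coordinate axes (four copies of the table,
one for each of the four directions `(±cos θ, ±sin θ)` of motion) gives the plane region
`{(X, Y) | (|X|, |Y|) ∈ table}`, with the sides identified as follows:
* horizontal sides: `(X, p n) ~ (X, -p n)` for `n ≤ |X| ≤ n + 1`;
* vertical sides: `(k, Y) ~ (-k, Y)` for `k ≥ 1` and `p k ≤ |Y| ≤ p (k-1)`.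

After unfolding, the motion is always in the direction `(cos θ, sin θ)`. We use the right-open
representatives: a point over `[n, n+1[` has `Y ∈ [-h, h[` with `h = halfWidth n`, and a point on
the vertical side at abscissa `k` is represented by `(-k, Y)`, the point at which the motion
continues. The singular vertex `(±k, ±p k)` of angle `6π` then has the three representatives
`(k, -p k)`, `(-k, -p k)`, `(-k, p k)`, one for each of the three trajectories that leave it. -/
def surface (P : StepBilliard) : Set (ℝ × ℝ) :=
  {q | q.2 ∈ Set.Ico (-P.halfWidth ⌊q.1⌋) (P.halfWidth ⌊q.1⌋)}

/-- Identification of the horizontal sides: the representative in `[-h, h[` of `y` modulo `2h`. -/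
noncomputable def wrap (h y : ℝ) : ℝ :=
  y - 2 * h * (⌊(y + h) / (2 * h)⌋ : ℝ)

/-- What happens at the point `(k, y)`, reached from the left, for an integer abscissa `k`: if
`k ≥ 1` and `y` is outside the aperture `[-p k, p k[`, then the point is on a vertical side and the
motion continues from `(-k, y)`; otherwise the motion goes on through `(k, y)`. The right-open
aperture is the convention (continuity from above) for trajectories that hit a vertex. -/
noncomputable def glue (P : StepBilliard) (k : ℤ) (y : ℝ) : ℝ × ℝ :=
  if 0 < k ∧ ¬ (-P.p k.toNat ≤ y ∧ y < P.p k.toNat) then (-(k : ℝ), y) else ((k : ℝ), y)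

/-- `γ`, defined for all times, is a trajectory of the unit speed billiard flow in direction `θ`
on the invariant surface. -/
structure IsTrajectory (P : StepBilliard) (θ : ℝ) (γ : ℝ → ℝ × ℝ) : Prop where
  mem_surface : ∀ t, γ t ∈ P.surface
  /-- motion inside the strip `[n, n+1[ × ℝ`, `n = ⌊X⌋` -/
  inside : ∀ t s : ℝ, 0 ≤ s → (γ t).1 + s * Real.cos θ < (⌊(γ t).1⌋ : ℝ) + 1 →
    γ (t + s) = ((γ t).1 + s * Real.cos θ,
      wrap (P.halfWidth ⌊(γ t).1⌋) ((γ t).2 + s * Real.sin θ))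
  /-- passage through, or collision at, the abscissa `n + 1` -/
  crossing : ∀ t s : ℝ, 0 ≤ s → (γ t).1 + s * Real.cos θ = (⌊(γ t).1⌋ : ℝ) + 1 →
    γ (t + s) = P.glue (⌊(γ t).1⌋ + 1)
      (wrap (P.halfWidth ⌊(γ t).1⌋) ((γ t).2 + s * Real.sin θ))

/-- The curve `L = {0} × [-p 0, p 0[ = {0} × [-1, 1[` that represents the first vertical side. -/
def leftSide (P : StepBilliard) : Set (ℝ × ℝ) :=
  {q | q.1 = 0 ∧ q.2 ∈ Set.Ico (-P.p 0) (P.p 0)}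

/-- The points of the surface on vertical sides of the table: the first side `L`, and the sides
at the abscissas `k ≥ 1`, whose points are represented at `X = -k`. -/
def verticalSides (P : StepBilliard) : Set (ℝ × ℝ) :=
  P.leftSide ∪ {q | q ∈ P.surface ∧
    ∃ k : ℕ, 1 ≤ k ∧ q.1 = -(k : ℝ) ∧ q.2 ∉ Set.Ico (-P.p k) (P.p k)}

/-- The `n`-th aperture `G_n = {n} × [-p n, p n[`. -/
def aperture (P : StepBilliard) (n : ℕ) : Set (ℝ × ℝ) :=
  {q | q.1 = (n : ℝ) ∧ q.2 ∈ Set.Ico (-P.p n) (P.p n)}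

/-- `E_θ^(n)`, with `L` identified with `[-1, 1[`: the points of `L` whose forward orbit reaches
the aperture `G_n` without colliding with any vertical side after it has left `L`. -/
def reachSet (P : StepBilliard) (θ : ℝ) (n : ℕ) : Set ℝ :=
  {y | (0, y) ∈ P.leftSide ∧ ∃ γ : ℝ → ℝ × ℝ, P.IsTrajectory θ γ ∧ γ 0 = (0, y) ∧
    ∃ t : ℝ, 0 < t ∧ γ t ∈ P.aperture n ∧ ∀ s ∈ Set.Ioc 0 t, γ s ∉ P.verticalSides}

/-- `E_θ`, the intersection of the sets `E_θ^(n)` over `n ≥ 1`. -/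
def escapeSet (P : StepBilliard) (θ : ℝ) : Set ℝ :=
  ⋂ n : ℕ, ⋂ _ : 1 ≤ n, P.reachSet θ n

/-- `O` is an escape orbit of the flow in direction `θ`: a (full) orbit which, from some time on,
never collides with a vertical side, and goes to infinity. -/
def IsEscapeOrbit (P : StepBilliard) (θ : ℝ) (O : Set (ℝ × ℝ)) : Prop :=
  ∃ γ : ℝ → ℝ × ℝ, P.IsTrajectory θ γ ∧ O = Set.range γ ∧
    (∃ t₀ : ℝ, ∀ t : ℝ, t₀ < t → γ t ∉ P.verticalSides) ∧
    Filter.Tendsto (fun t => (γ t).1) Filter.atTop Filter.atTop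

end StepBilliard

/-!
Put `α = tan θ`. Between the apertures `G_m` and `G_(m+d)` the motion is a composition of
rotations of the circles `[-p k, p k[`, so the heights in `G_m` from which it flies directly to
`G_(m+d)` form one half-open interval of length `2 p (m+d)`, unless the flight from the lower vertex
of some `G_k`, `m ≤ k < m+d`, to `G_(m+d)` is direct and cuts this interval.

A direct flight over `j + 1` strips occupies, in a ball of radius `r`, slopes of measure at most
`(3 λ)^(j+1) / (3 (j+1)) * (2 r + 4 p k)`: the geometric decay of the heights loses a factor `3` per
strip to branching. The sum over `j` is `κ (2 r + 4 p m)` with `κ = -log (1 - 3 λ) / 3`, and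
`4 p m → 0`. If `κ < 1`, that is, `λ < (1 - exp (-3)) / 3`, then by Lebesgue density almost every
`α` is uncut for some `m` and infinitely many `d`. The nested intervals then shrink to at most one
height, and, being half-open on the right, to exactly one if no right end recurs. A right end that
recurs puts a nonzero multiple of `α` in the countable group generated by the `p n`.

The return map to the integer abscissas is a rotation followed by two involutions. It is therefore
invertible, trajectories are determined in both directions of time, and two escape orbits can be
compared at a common abscissa.
-/

open Set MeasureTheory Filter Topology

namespace StepBilliard

section Wrap

variable {h : ℝ}

theorem wrap_eq_iff (hh : 0 < h) {y w : ℝ} :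
    wrap h y = w ↔ w ∈ Ico (-h) h ∧ ∃ a : ℤ, y = w + a * (2 * h) := by
  have hp : 0 < 2 * h := by positivity
  have hwrap : wrap h y = toIcoMod hp (-h) y := by
    rw [toIcoMod, toIcoDiv_eq_floor, wrap, zsmul_eq_mul, sub_neg_eq_add, mul_comm]
  rw [hwrap, toIcoMod_eq_iff, show -h + 2 * h = h by ring]
  simp only [zsmul_eq_mul]

theorem wrap_mem (hh : 0 < h) (y : ℝ) : wrap h y ∈ Ico (-h) h :=
  ((wrap_eq_iff hh).1 rfl).1

theorem exists_eq_wrap_add (hh : 0 < h) (y : ℝ) : ∃ a : ℤ, y = wrap h y + a * (2 * h) :=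
  ((wrap_eq_iff hh).1 rfl).2

theorem wrap_of_mem {y : ℝ} (hy : y ∈ Ico (-h) h) : wrap h y = y :=
  (wrap_eq_iff (by linarith [hy.1, hy.2])).2 ⟨hy, 0, by simp⟩

theorem wrap_wrap_add (hh : 0 < h) (x y : ℝ) : wrap h (wrap h x + y) = wrap h (x + y) := by
  obtain ⟨a, ha⟩ := exists_eq_wrap_add hh x
  obtain ⟨b, hb⟩ := exists_eq_wrap_add hh (x + y)
  refine (wrap_eq_iff hh).2 ⟨wrap_mem hh _, b - a, ?_⟩
  push_cast
  linarith

theorem wrap_wrap_add_add_neg {y : ℝ} (α : ℝ) (hy : y ∈ Ico (-h) h) :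
    wrap h (wrap h (y + α) + -α) = y := by
  rw [wrap_wrap_add (by linarith [hy.1, hy.2]), add_neg_cancel_right, wrap_of_mem hy]

theorem setOf_wrap_add_mem_Ico {l x α : ℝ} (hl : 0 < l) (hx : Ico x (x + l) ⊆ Ico (-h) h)
    (hα : wrap h (-h + α) ∉ Ico x (x + l)) :
    {y ∈ Ico (-h) h | wrap h (y + α) ∈ Ico x (x + l)} =
      Ico (wrap h (x - α)) (wrap h (x - α) + l) := by
  obtain ⟨hx₁, hx₂⟩ := (Ico_subset_Ico_iff (by linarith)).1 hx
  have hh : 0 < h := by linarith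
  obtain ⟨ha₁, ha₂⟩ := wrap_mem hh (x - α)
  obtain ⟨a, ha⟩ := exists_eq_wrap_add hh (x - α)
  set x' := wrap h (x - α)
  have hx' : x' + l ≤ h := by
    by_contra! hlt
    have hw : wrap h (-h + α) = x + (h - x') :=
      (wrap_eq_iff hh).2 ⟨⟨by linarith, by linarith⟩, -1 - a, by push_cast; linarith⟩
    exact hα (hw ▸ ⟨by linarith, by linarith⟩)
  ext y
  constructor
  · rintro ⟨hy, hw₁, hw₂⟩
    obtain ⟨b, hb⟩ := exists_eq_wrap_add hh (y + α)
    set w := wrap h (y + α)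
    have hyw : wrap h y = x' + (w - x) :=
      (wrap_eq_iff hh).2 ⟨⟨by linarith, by linarith⟩, a + b, by push_cast; linarith⟩
    rw [wrap_of_mem hy] at hyw
    exact hyw ▸ ⟨by linarith, by linarith⟩
  · rintro ⟨hy₁, hy₂⟩
    have hw : wrap h (y + α) = x + (y - x') :=
      (wrap_eq_iff hh).2 ⟨⟨by linarith, by linarith⟩, -a, by push_cast; linarith⟩
    exact ⟨⟨by linarith, by linarith⟩, hw ▸ ⟨by linarith, by linarith⟩⟩

end Wrap

section DirectFlight

/-- The heights in the aperture `G_m = [-p m, p m[` from which the motion with slope `α` passes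
directly, that is, without collision, through the `d` apertures that follow. -/
def directSet (p : ℕ → ℝ) (α : ℝ) : ℕ → ℕ → Set ℝ
  | m, 0 => Ico (-p m) (p m)
  | m, d + 1 => {y ∈ Ico (-p m) (p m) | wrap (p m) (y + α) ∈ directSet p α (m + 1) d}

/-- The heights in the aperture `G_m` from which the motion with slope `α` never collides again. -/
def escapeHeights (p : ℕ → ℝ) (α : ℝ) (m : ℕ) : Set ℝ :=
  {y | ∀ d, y ∈ directSet p α m d}

/-- The slopes for which the motion that starts at the lower vertex of the aperture `G_k` passes
directly through `G_(k+1), …, G_(k+1+d)`. -/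
def vertexSet (p : ℕ → ℝ) (k d : ℕ) : Set ℝ :=
  {α | wrap (p k) (-p k + α) ∈ directSet p α (k + 1) d}

/-- The slopes for which the lower vertex of one of the apertures `G_m, …, G_(m+d-1)` flies
directly to `G_(m+d)`. For all other slopes, `directSet p α m d` is not cut into pieces. -/
def cutSet (p : ℕ → ℝ) : ℕ → ℕ → Set ℝ
  | _, 0 => ∅
  | m, d + 1 => vertexSet p m d ∪ cutSet p (m + 1) d

variable {p : ℕ → ℝ} {α : ℝ} {m : ℕ}

theorem directSet_subset (d : ℕ) : directSet p α m d ⊆ Ico (-p m) (p m) := by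
  cases d with
  | zero => exact Subset.rfl
  | succ d => exact sep_subset _ _

theorem antitone_directSet : Antitone (directSet p α m) := by
  refine antitone_nat_of_succ_le fun d => ?_
  induction d generalizing m with
  | zero => exact directSet_subset 1
  | succ d ih => exact fun y hy => ⟨hy.1, ih hy.2⟩

theorem Ico_neg_subset_Ico_neg {a b : ℝ} (hab : a ≤ b) : Ico (-a) a ⊆ Ico (-b) b :=
  Ico_subset_Ico (neg_le_neg hab) hab

theorem exists_directSet_eq_Ico (hpos : ∀ n, 0 < p n) (hanti : Antitone p) {d : ℕ}
    (hα : α ∉ cutSet p m d) :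
    ∃ x, x + d * α ∈ AddSubgroup.closure (range p) ∧
      directSet p α m d = Ico x (x + 2 * p (m + d)) := by
  have hp_mem (n : ℕ) : p n ∈ AddSubgroup.closure (range p) :=
    AddSubgroup.subset_closure (mem_range_self n)
  induction d generalizing m with
  | zero =>
    refine ⟨-p m, by simpa using hp_mem m, ?_⟩
    rw [directSet, add_zero, two_mul, neg_add_cancel_left]
  | succ d ih =>
    obtain ⟨hvertex, hcut⟩ := not_or.1 hα
    obtain ⟨x, hx, hdirect⟩ := ih hcut
    have hsub : Ico x (x + 2 * p (m + 1 + d)) ⊆ Ico (-p m) (p m) :=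
      hdirect ▸ (directSet_subset d).trans (Ico_neg_subset_Ico_neg (hanti m.le_succ))
    rw [vertexSet, mem_ofPred_eq, hdirect] at hvertex
    refine ⟨wrap (p m) (x - α), ?_, ?_⟩
    · obtain ⟨a, ha⟩ := exists_eq_wrap_add (hpos m) (x - α)
      have hmem := sub_mem hx (zsmul_mem (nsmul_mem (hp_mem m) 2) a)
      convert hmem using 1
      push_cast [zsmul_eq_mul, nsmul_eq_mul]
      linarith
    · rw [directSet, hdirect, setOf_wrap_add_mem_Ico (by linarith [hpos (m + 1 + d)]) hsub hvertex,
        add_right_comm m 1 d, add_assoc m d 1]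

theorem existsUnique_forall_mem_Ico {a b : ℕ → ℝ} (ha : Monotone a) (hb : StrictAnti b)
    (hab : a ≤ b) (hlim : Tendsto (fun n => b n - a n) atTop (𝓝 0)) :
    ∃! y, ∀ n, y ∈ Ico (a n) (b n) := by
  have hsup := mem_iInter.1 (ha.ciSup_mem_iInter_Icc_of_antitone hb.antitone hab)
  refine ⟨⨆ n, a n, fun n => ⟨(hsup n).1, (hsup (n + 1)).2.trans_lt (hb n.lt_succ_self)⟩,
    fun y hy => eq_of_abs_sub_nonpos (ge_of_tendsto' hlim fun n => abs_le.2 ?_)⟩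
  constructor <;> linarith [(hy n).1, (hy n).2, (hsup n).1, (hsup n).2]

theorem encard_escapeHeights_eq_one (hpos : ∀ n, 0 < p n) (hanti : Antitone p)
    (hlim : Tendsto p atTop (𝓝 0))
    (hα : ∀ d : ℕ, 0 < d → d * α ∉ AddSubgroup.closure (range p))
    (hcut : ∃ᶠ d in atTop, α ∉ cutSet p m d) : (escapeHeights p α m).encard = 1 := by
  obtain ⟨φ, hφ, hφ_cut⟩ := extraction_of_frequently_atTop hcut
  choose x hx_mem hx using fun k => exists_directSet_eq_Ico hpos hanti (hφ_cut k)
  set b : ℕ → ℝ := fun k => x k + 2 * p (m + φ k) with hb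
  have hxb (k : ℕ) : x k < b k := by linarith [hpos (m + φ k)]
  have hnested {i j : ℕ} (hij : i ≤ j) : x i ≤ x j ∧ b j ≤ b i := by
    rw [← Ico_subset_Ico_iff (hxb j), ← hx, ← hx]
    exact antitone_directSet (hφ.monotone hij)
  have hb_mem (k : ℕ) : b k + φ k * α ∈ AddSubgroup.closure (range p) := by
    convert add_mem (hx_mem k) (nsmul_mem (AddSubgroup.subset_closure
      (mem_range_self (m + φ k))) 2) using 1
    rw [hb, nsmul_eq_mul]
    push_cast
    ring
  have hb_ne {i j : ℕ} (hij : i < j) : b i ≠ b j := fun heq => by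
    have hlt := hφ hij
    refine hα (φ j - φ i) (Nat.sub_pos_of_lt hlt) ?_
    convert sub_mem (hb_mem j) (hb_mem i) using 1
    rw [Nat.cast_sub hlt.le, heq]
    ring
  have hb_anti : StrictAnti b := fun i j hij => (hnested hij.le).2.lt_of_ne' (hb_ne hij)
  have hlength : Tendsto (fun k => b k - x k) atTop (𝓝 0) := by
    simpa [hb] using (hlim.comp (tendsto_atTop_mono (fun k => Nat.le_add_left _ m)
      hφ.tendsto_atTop)).const_mul 2
  obtain ⟨y, hy, huniq⟩ := existsUnique_forall_mem_Ico (fun i j hij => (hnested hij).1) hb_anti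
    (fun k => (hxb k).le) hlength
  refine encard_eq_one.2 ⟨y, eq_singleton_iff_unique_mem.2 ⟨fun d => ?_, fun z hz => ?_⟩⟩
  · exact antitone_directSet (hφ.le_apply (x := d)) (hx d ▸ hy d)
  · exact huniq z fun k => hx k ▸ hz (φ k)

theorem image_escapeHeights (hpos : ∀ n, 0 < p n) (hanti : Antitone p) :
    (fun y => wrap (p m) (y + α)) '' escapeHeights p α m = escapeHeights p α (m + 1) := by
  refine Subset.antisymm (image_subset_iff.2 fun y hy d => (hy (d + 1)).2) fun w hw => ?_
  have hw_inv : wrap (p m) (wrap (p m) (w + -α) + α) = w := by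
    simpa using wrap_wrap_add_add_neg (-α) (Ico_neg_subset_Ico_neg (hanti m.le_succ) (hw 0))
  refine ⟨wrap (p m) (w + -α), fun d => ?_, hw_inv⟩
  refine antitone_directSet d.le_succ ⟨wrap_mem (hpos m) _, ?_⟩
  rw [hw_inv]
  exact hw d

theorem encard_escapeHeights (hpos : ∀ n, 0 < p n) (hanti : Antitone p) :
    (escapeHeights p α m).encard = (escapeHeights p α 0).encard := by
  induction m with
  | zero => rfl
  | succ m ih =>
    have hinj : InjOn (fun y => wrap (p m) (y + α)) (escapeHeights p α m) :=
      LeftInvOn.injOn (f₁' := fun w => wrap (p m) (w + -α))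
        fun y hy => wrap_wrap_add_add_neg α (hy 0)
    rw [← image_escapeHeights hpos hanti, hinj.encard_image, ih]

end DirectFlight

section Measure

theorem card_Icc_ceil_floor_le {x y : ℝ} :
    (Finset.Icc ⌈x⌉ ⌊y⌋).card ≤ ⌊y - x⌋₊ + 1 := by
  have hle : ⌊y⌋ - ⌈x⌉ ≤ ⌊y - x⌋ := Int.le_floor.2 <| by
    push_cast
    linarith [Int.floor_le y, Int.le_ceil x]
  rw [Int.card_Icc, ← Int.floor_toNat]
  omega

theorem volume_setOf_wrap_mem_le {h q s c u v : ℝ} {M : ENNReal} {B : ℝ → Set ℝ} (hh : 0 < h)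
    (hs : 0 ≤ s) (hB : ∀ α, B α ⊆ Ico (-q) q)
    (hM : ∀ a : ℤ, volume {α | s * α + (c - a * (2 * h)) ∈ B α} ≤ M) :
    volume {α ∈ Icc u v | wrap h (s * α + c) ∈ B α} ≤
      ((⌊(s * (v - u) / 2 + q) / h⌋₊ + 1 : ℕ) : ENNReal) * M := by
  set lo := (s * u + c - q) / (2 * h) with hlo
  set hi := (s * v + c + q) / (2 * h) with hhi
  have hcover : {α ∈ Icc u v | wrap h (s * α + c) ∈ B α} ⊆
      ⋃ a ∈ Finset.Icc ⌈lo⌉ ⌊hi⌋, {α | s * α + (c - a * (2 * h)) ∈ B α} := by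
    rintro α ⟨⟨huα, hαv⟩, hα⟩
    obtain ⟨a, ha⟩ := exists_eq_wrap_add hh (s * α + c)
    obtain ⟨hq₁, hq₂⟩ := hB α hα
    have hu := mul_le_mul_of_nonneg_left huα hs
    have hv := mul_le_mul_of_nonneg_left hαv hs
    refine mem_iUnion₂.2 ⟨a, Finset.mem_Icc.2 ⟨Int.ceil_le.2 ?_, Int.le_floor.2 ?_⟩, ?_⟩
    · rw [div_le_iff₀ (by positivity)]
      linarith
    · rw [le_div_iff₀ (by positivity)]
      linarith
    · rwa [mem_ofPred_eq, ← add_sub_assoc, sub_eq_of_eq_add ha]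
  have hlength : hi - lo = (s * (v - u) / 2 + q) / h := by
    rw [hlo, hhi]
    field_simp
    ring
  calc _ ≤ ∑ a ∈ Finset.Icc ⌈lo⌉ ⌊hi⌋, volume {α | s * α + (c - a * (2 * h)) ∈ B α} :=
        (measure_mono hcover).trans (measure_biUnion_finset_le _ _)
    _ ≤ (Finset.Icc ⌈lo⌉ ⌊hi⌋).card * M := by
        rw [← nsmul_eq_mul]
        exact Finset.sum_le_card_nsmul _ _ _ fun a _ => hM a
    _ ≤ _ := by
        rw [← hlength]
        gcongr
        exact card_Icc_ceil_floor_le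

variable {p : ℕ → ℝ} {lam : ℝ}

/-- A slope enters as an affine function `s * α + c` of it, the height of the motion after `s`
steps. Each further step has at most three branches, which the factor `3 ^ d` counts, and raises
the factor `s` of the slope by one. -/
theorem volume_setOf_mem_directSet_le (hpos : ∀ n, 0 < p n) (hanti : StrictAnti p) {s : ℝ}
    (hs : 1 ≤ s) (c : ℝ) (m d : ℕ) :
    volume {α | s * α + c ∈ directSet p α m d} ≤
      3 ^ d * ENNReal.ofReal (2 * p (m + d) / (s + d)) := by
  have hIcc {s : ℝ} (hs : 1 ≤ s) (c : ℝ) (m : ℕ) {α : ℝ} (hα : s * α + c ∈ Ico (-p m) (p m)) :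
      α ∈ Icc ((-p m - c) / s) ((p m - c) / s) := by
    rw [mem_Icc, div_le_iff₀ (by linarith), le_div_iff₀ (by linarith)]
    constructor <;> linarith [hα.1, hα.2]
  have hlength (s c : ℝ) (m : ℕ) : (p m - c) / s - (-p m - c) / s = 2 * p m / s := by ring
  induction d generalizing m s c with
  | zero =>
    refine (measure_mono fun α hα => hIcc hs c m hα).trans ?_
    rw [Real.volume_Icc, hlength]
    simp
  | succ d ih =>
    have hsub : {α | s * α + c ∈ directSet p α m (d + 1)} ⊆
        {α ∈ Icc ((-p m - c) / s) ((p m - c) / s) |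
          wrap (p m) ((s + 1) * α + c) ∈ directSet p α (m + 1) d} := fun α hα =>
      ⟨hIcc hs c m hα.1, by rw [show (s + 1) * α + c = s * α + c + α by ring]; exact hα.2⟩
    have hbranches :
        ⌊((s + 1) * ((p m - c) / s - (-p m - c) / s) / 2 + p (m + 1)) / p m⌋₊ + 1 ≤ 3 := by
      refine Nat.succ_le_of_lt ((Nat.floor_lt' three_ne_zero).2 ?_)
      rw [hlength, div_lt_iff₀ (hpos m)]
      have hratio : (s + 1) * (2 * p m / s) / 2 = p m + p m / s := by field_simp
      have hdiv : p m / s ≤ p m := div_le_self (hpos m).le hs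
      push_cast
      linarith [hanti m.lt_succ_self]
    refine (measure_mono hsub).trans ((volume_setOf_wrap_mem_le (hpos m) (by linarith)
      (fun _ => directSet_subset d) fun a => ih (by linarith) _ (m + 1)).trans ?_)
    rw [← mul_assoc, pow_succ', add_right_comm m 1 d, add_assoc m d 1, Nat.cast_succ d,
      add_comm (d : ℝ) 1, ← add_assoc s 1]
    gcongr
    exact_mod_cast hbranches

theorem volume_vertexSet_inter_le (hpos : ∀ n, 0 < p n) (hanti : StrictAnti p)
    (hp : ∀ n, p (n + 1) ≤ lam * p n) (k d : ℕ) (x r : ℝ) (hr : 0 ≤ r) :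
    volume (vertexSet p k d ∩ Metric.closedBall x r) ≤
      ENNReal.ofReal ((3 * lam) ^ (d + 1) / (d + 1) / 3 * (2 * r + 4 * p k)) := by
  have hlam : 0 ≤ lam := nonneg_of_mul_nonneg_left ((hpos 1).le.trans (hp 0)) (hpos 0)
  have hgeom : p (k + 1 + d) ≤ lam ^ (d + 1) * p k := by
    rw [add_right_comm, add_assoc]
    exact le_geom (u := fun n => p (k + n)) hlam (d + 1) fun n _ => hp (k + n)
  have hsub : vertexSet p k d ∩ Metric.closedBall x r ⊆
      {α ∈ Icc (x - r) (x + r) | wrap (p k) (1 * α + -p k) ∈ directSet p α (k + 1) d} := by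
    rintro α ⟨hα, hball⟩
    rw [Real.closedBall_eq_Icc] at hball
    refine ⟨hball, ?_⟩
    rwa [one_mul, add_comm α]
  have hbranches : ((⌊(1 * (x + r - (x - r)) / 2 + p (k + 1)) / p k⌋₊ + 1 : ℕ) : ℝ) ≤
      r / p k + 2 := by
    have hfloor : (⌊(1 * (x + r - (x - r)) / 2 + p (k + 1)) / p k⌋₊ : ℝ) ≤
      (1 * (x + r - (x - r)) / 2 + p (k + 1)) / p k :=
      Nat.floor_le (div_nonneg (by linarith [hpos (k + 1)]) (hpos k).le)
    have hratio : p (k + 1) / p k ≤ 1 := (div_le_one (hpos k)).2 (hanti k.lt_succ_self).le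
    have hsplit : (1 * (x + r - (x - r)) / 2 + p (k + 1)) / p k = r / p k + p (k + 1) / p k := by
      ring
    push_cast
    linarith
  refine (measure_mono hsub).trans ((volume_setOf_wrap_mem_le (hpos k) zero_le_one
    (fun _ => directSet_subset d) fun a =>
      volume_setOf_mem_directSet_le hpos hanti le_rfl _ (k + 1) d).trans ?_)
  rw [← ENNReal.ofReal_natCast, ← ENNReal.ofReal_ofNat, ← ENNReal.ofReal_pow (by norm_num),
    ← ENNReal.ofReal_mul (by positivity), ← ENNReal.ofReal_mul (by positivity)]
  refine ENNReal.ofReal_le_ofReal ?_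
  have := hpos k
  have := hpos (k + 1 + d)
  calc _ ≤ (r / p k + 2) * (3 ^ d * (2 * (lam ^ (d + 1) * p k) / (1 + d))) := by gcongr
    _ = _ := by
      rw [mul_pow, pow_succ 3 d]
      field_simp
      ring

theorem volume_cutSet_inter_le (hpos : ∀ n, 0 < p n) (hanti : StrictAnti p)
    (hp : ∀ n, p (n + 1) ≤ lam * p n) (m d : ℕ) (x r : ℝ) (hr : 0 ≤ r) :
    volume (cutSet p m d ∩ Metric.closedBall x r) ≤ ENNReal.ofReal
      ((∑ j ∈ Finset.range d, (3 * lam) ^ (j + 1) / (j + 1)) / 3 * (2 * r + 4 * p m)) := by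
  have hlam : 0 ≤ lam := nonneg_of_mul_nonneg_left ((hpos 1).le.trans (hp 0)) (hpos 0)
  induction d generalizing m with
  | zero => simp [cutSet]
  | succ d ih =>
    have hm := hpos m
    have hm₁ := hpos (m + 1)
    rw [cutSet, union_inter_distrib_right]
    refine (measure_union_le _ _).trans ((add_le_add
      (volume_vertexSet_inter_le hpos hanti hp m d x r hr) (ih (m + 1))).trans ?_)
    rw [← ENNReal.ofReal_add (by positivity) (by positivity), Finset.sum_range_succ, add_div,
      add_mul, add_comm]
    gcongr
    exact (hanti m.lt_succ_self).le

theorem measure_eq_zero_of_measure_inter_closedBall_le {X : Type*} [MetricSpace X]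
    [MeasurableSpace X] [BorelSpace X] [SecondCountableTopology X] [HasBesicovitchCovering X]
    {μ : Measure X} [IsLocallyFiniteMeasure μ] {s : Set X} {c : ENNReal} (hc : c < 1)
    (hs : ∀ x, ∃ᶠ r in 𝓝[>] 0, μ (s ∩ Metric.closedBall x r) ≤ c * μ (Metric.closedBall x r)) :
    μ s = 0 := by
  rw [← Measure.restrict_eq_zero, ← ae_eq_bot, ← eventually_false_iff_eq_bot]
  filter_upwards [Besicovitch.ae_tendsto_measure_inter_div μ s] with x hx
  obtain ⟨r, hr, hlt⟩ := ((hs x).and_eventually (hx.eventually_const_lt hc)).exists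
  exact hlt.not_ge (ENNReal.div_le_of_le_mul hr)

theorem measure_setOf_eventually_mem_le {X : Type*} [MeasurableSpace X] {μ : Measure X}
    {s : ℕ → Set X} {c : ENNReal} (hs : ∀ n, μ (s n) ≤ c) :
    μ {x | ∀ᶠ n in atTop, x ∈ s n} ≤ c := by
  have hUnion : {x | ∀ᶠ n in atTop, x ∈ s n} = ⋃ N, ⋂ n ≥ N, s n := by
    ext x
    simp [eventually_atTop]
  have hmono : Monotone fun N => ⋂ n ≥ N, s n := fun M N hMN =>
    biInter_mono (fun _ hn => hMN.trans hn) fun _ _ => Subset.rfl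
  rw [hUnion, hmono.measure_iUnion]
  exact iSup_le fun N => (measure_mono (biInter_subset_of_mem le_rfl)).trans (hs N)

theorem neg_log_one_sub_div_three_lt_one {x : ℝ} (hx : x < 1 - Real.exp (-3)) :
    -Real.log (1 - x) / 3 < 1 := by
  have := (Real.lt_log_iff_exp_lt (by linarith [Real.exp_pos (-3)])).2
    (lt_sub_comm.1 hx)
  linarith

theorem ae_exists_frequently_notMem_cutSet (hpos : ∀ n, 0 < p n) (hlim : Tendsto p atTop (𝓝 0))
    (hlam : lam < (1 - Real.exp (-3)) / 3) (hp : ∀ n, p (n + 1) ≤ lam * p n) :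
    ∀ᵐ α : ℝ, ∃ m, ∃ᶠ d in atTop, α ∉ cutSet p m d := by
  have hlam₀ : 0 ≤ lam := nonneg_of_mul_nonneg_left ((hpos 1).le.trans (hp 0)) (hpos 0)
  have hlam₁ : 3 * lam < 1 - Real.exp (-3) := by linarith
  have hlam₂ : 3 * lam < 1 := by linarith [Real.exp_pos (-3)]
  have hanti : StrictAnti p := strictAnti_nat_of_succ_lt fun n =>
    (hp n).trans_lt (mul_lt_of_lt_one_left (hpos n) (by linarith))
  set κ := -Real.log (1 - 3 * lam) / 3 with hκ
  have hκ₀ : 0 ≤ κ :=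
    div_nonneg (neg_nonneg.2 (Real.log_nonpos (by linarith) (by linarith))) zero_le_three
  have hsum (d : ℕ) : (∑ j ∈ Finset.range d, (3 * lam) ^ (j + 1) / (j + 1)) / 3 ≤ κ := by
    rw [hκ]
    gcongr
    exact sum_le_hasSum _ (fun _ _ => by positivity)
      (Real.hasSum_pow_div_log_of_abs_lt_one (by rwa [abs_of_nonneg (by positivity)]))
  set Z := {α | ∀ m, ∀ᶠ d in atTop, α ∈ cutSet p m d}
  have hball (m : ℕ) (x r : ℝ) (hr : 0 ≤ r) :
      volume (Z ∩ Metric.closedBall x r) ≤ ENNReal.ofReal (κ * (2 * r + 4 * p m)) := by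
    refine (measure_mono ?_).trans (measure_setOf_eventually_mem_le fun d =>
      (volume_cutSet_inter_le hpos hanti hp m d x r hr).trans ?_)
    · exact fun α hα => (hα.1 m).mono fun d hd => ⟨hd, hα.2⟩
    · have := hpos m
      gcongr
      exact hsum d
  have hZ : volume Z = 0 := by
    refine measure_eq_zero_of_measure_inter_closedBall_le (c := ENNReal.ofReal κ) ?_ fun x =>
      Eventually.frequently ?_
    · rw [ENNReal.ofReal_lt_one]
      exact neg_log_one_sub_div_three_lt_one hlam₁
    · filter_upwards [self_mem_nhdsWithin] with r hr
      rw [Real.volume_closedBall, ← ENNReal.ofReal_mul hκ₀]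
      refine ge_of_tendsto' (x := atTop) (ENNReal.tendsto_ofReal ?_)
        fun m => hball m x r (le_of_lt hr)
      simpa using ((hlim.const_mul 4).const_add (2 * r)).const_mul κ
  filter_upwards [measure_eq_zero_iff_ae_notMem.1 hZ] with α hα
  simpa only [Z, mem_ofPred_eq, not_forall, not_eventually] using hα

theorem countable_closure_range (p : ℕ → ℝ) :
    (AddSubgroup.closure (range p) : Set ℝ).Countable := by
  have hrange : (AddSubgroup.closure (range p) : Set ℝ) =
      range (Finsupp.linearCombination ℤ p) := by
    rw [← LinearMap.coe_range, Finsupp.range_linearCombination,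
      ← Submodule.span_int_eq_addSubgroupClosure]
    rfl
  exact hrange ▸ countable_range _

theorem ae_forall_mul_notMem_of_countable {s : Set ℝ} (hs : s.Countable) :
    ∀ᵐ α : ℝ, ∀ d : ℕ, 0 < d → d * α ∉ s := by
  refine ae_all_iff.2 fun d => eventually_imp_distrib_left.2 fun hd => ?_
  exact (hs.preimage (mul_right_injective₀ (Nat.cast_ne_zero.2 hd.ne'))).ae_notMem volume

theorem ae_encard_escapeHeights (hpos : ∀ n, 0 < p n) (hlim : Tendsto p atTop (𝓝 0))
    (hlam : lam < (1 - Real.exp (-3)) / 3) (hp : ∀ n, p (n + 1) ≤ lam * p n) :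
    ∀ᵐ α : ℝ, (escapeHeights p α 0).encard = 1 := by
  have hanti : Antitone p := antitone_nat_of_succ_le fun n =>
    (hp n).trans (mul_le_of_le_one_left (hpos n).le (by linarith [Real.exp_pos (-3)]))
  filter_upwards [ae_exists_frequently_notMem_cutSet hpos hlim hlam hp,
    ae_forall_mul_notMem_of_countable (countable_closure_range p)] with α ⟨m, hcut⟩ hα
  rw [← encard_escapeHeights hpos hanti (m := m)]
  exact encard_escapeHeights_eq_one hpos hanti hlim hα hcut

theorem ae_restrict_tan {s : Set ℝ} (hs : ∀ᵐ α : ℝ, α ∈ s) :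
    ∀ᵐ θ ∂(volume.restrict (Ioo (-(Real.pi / 2)) (Real.pi / 2))), Real.tan θ ∈ s := by
  rw [ae_restrict_iff' measurableSet_Ioo]
  have himage := addHaar_image_eq_zero_of_differentiableOn_of_addHaar_eq_zero volume
    (f := Real.arctan) (s := sᶜ) Real.differentiable_arctan.differentiableOn hs
  filter_upwards [measure_eq_zero_iff_ae_notMem.1 himage] with θ hθ hmem
  by_contra htan
  exact hθ ⟨Real.tan θ, htan, Real.arctan_tan hmem.1 hmem.2⟩

end Measure

section ReturnMap

variable {P : StepBilliard} {α : ℝ}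

theorem halfWidth_natCast (n : ℕ) : P.halfWidth n = P.p n := by
  simp [halfWidth]

theorem halfWidth_neg_sub_one (k : ℤ) : P.halfWidth (-k - 1) = P.halfWidth k := by
  unfold halfWidth
  split_ifs
  · omega
  · rfl
  · rw [neg_sub, sub_neg_eq_add, add_sub_cancel_left]
  · omega

theorem halfWidth_pos (k : ℤ) : 0 < P.halfWidth k := by
  unfold halfWidth
  split_ifs <;> exact P.p_pos _

theorem halfWidth_le_halfWidth_succ {k : ℤ} (hk : k < 0) :
    P.halfWidth k ≤ P.halfWidth (k + 1) := by
  unfold halfWidth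
  split_ifs <;> first | omega | exact P.p_antitone (by omega)

/-- The heights of the points of the surface at abscissas in `[k, k+1[`. -/
def fiber (P : StepBilliard) (k : ℤ) : Set ℝ :=
  Ico (-P.halfWidth k) (P.halfWidth k)

theorem fiber_neg_sub_one (k : ℤ) : P.fiber (-k - 1) = P.fiber k := by
  rw [fiber, fiber, halfWidth_neg_sub_one]

theorem fiber_natCast (n : ℕ) : P.fiber n = Ico (-P.p n) (P.p n) := by
  rw [fiber, halfWidth_natCast]

/-- A point `(level, height)` of the surface with an integer abscissa. These points form a cross
section of the flow. -/
@[ext]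
structure Section (P : StepBilliard) where
  level : ℤ
  height : ℝ
  height_mem : height ∈ P.fiber level

namespace Section

/-- A point of the cross section as a point of the plane. -/
def toPlane (q : P.Section) : ℝ × ℝ :=
  (q.level, q.height)

theorem toPlane_injective : Function.Injective (toPlane (P := P)) := by
  intro q r hqr
  obtain ⟨hlevel, hheight⟩ := Prod.ext_iff.1 hqr
  exact Section.ext (Int.cast_injective hlevel) hheight

theorem toPlane_mem_surface (q : P.Section) : q.toPlane ∈ P.surface := by
  rw [surface, toPlane, mem_ofPred_eq, Int.floor_intCast]
  exact q.height_mem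

/-- A point `(k, y)` of the cross section stands here for the right end `(k + 1, y)` of the strip
`[k, k+1[`, which may lie on a vertical side. -/
def Collides (q : P.Section) : Prop :=
  0 ≤ q.level ∧ q.height ∉ P.fiber (q.level + 1)

theorem height_mem_fiber_of_not_collides {q : P.Section} (hq : ¬q.Collides) :
    q.height ∈ P.fiber (q.level + 1) := by
  rw [Collides, not_and, not_not] at hq
  by_cases hk : 0 ≤ q.level
  · exact hq hk
  · exact Ico_neg_subset_Ico_neg (halfWidth_le_halfWidth_succ (not_le.1 hk)) q.height_mem

end Section

/-- The flight with slope `α` over a strip `[k, k+1[`, up to its right end. -/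
noncomputable def rotate (P : StepBilliard) (α : ℝ) : Equiv.Perm P.Section where
  toFun q := ⟨q.level, wrap (P.halfWidth q.level) (q.height + α), wrap_mem (halfWidth_pos _) _⟩
  invFun q := ⟨q.level, wrap (P.halfWidth q.level) (q.height + -α), wrap_mem (halfWidth_pos _) _⟩
  left_inv q := Section.ext rfl (wrap_wrap_add_add_neg α q.height_mem)
  right_inv q := Section.ext rfl (by simpa using wrap_wrap_add_add_neg (-α) q.height_mem)

/-- The symmetry `X ↦ -X` of the surface, which maps the strip `[k, k+1[` to `[-k-1, -k[`. -/
def mirror (P : StepBilliard) : Equiv.Perm P.Section :=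
  Function.Involutive.toPerm
    (fun q => ⟨-q.level - 1, q.height, fiber_neg_sub_one q.level ▸ q.height_mem⟩)
    fun q => Section.ext (by ring) rfl

open Classical in
/-- The passage from the right end of a strip `[k, k+1[` to the strip `[-k-1, -k[` after a
collision, and to `[k+1, k+2[` otherwise, followed by the symmetry `X ↦ -X`. The symmetry
exchanges the two ends of a strip, which makes this an involution. -/
noncomputable def mirrorPassage (P : StepBilliard) : Equiv.Perm P.Section :=
  Function.Involutive.toPerm
    (fun q => if hq : q.Collides then q else ⟨-(q.level + 1) - 1, q.height,
      (fiber_neg_sub_one _).symm ▸ q.height_mem_fiber_of_not_collides hq⟩) fun q => by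
    by_cases hq : q.Collides
    · simp only [hq, dite_true]
    · have hback : ¬Section.Collides (P := P) ⟨-(q.level + 1) - 1, q.height,
          (fiber_neg_sub_one _).symm ▸ q.height_mem_fiber_of_not_collides hq⟩ := fun hcoll =>
        hcoll.2 (by
          rw [show -(q.level + 1) - 1 + 1 = -q.level - 1 by ring, fiber_neg_sub_one]
          exact q.height_mem)
      simp only [hq, hback, dite_false]
      exact Section.ext (by ring) rfl

/-- The first return map of the flow with slope `α` to the cross section. -/
noncomputable def returnMap (P : StepBilliard) (α : ℝ) : Equiv.Perm P.Section :=
  (P.rotate α).trans (P.mirrorPassage.trans P.mirror)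

theorem mirrorPassage_of_collides {q : P.Section} (hq : q.Collides) : P.mirrorPassage q = q :=
  dif_pos hq

theorem mirrorPassage_of_not_collides {q : P.Section} (hq : ¬q.Collides) :
    P.mirrorPassage q = ⟨-(q.level + 1) - 1, q.height,
      (fiber_neg_sub_one _).symm ▸ q.height_mem_fiber_of_not_collides hq⟩ :=
  dif_neg hq

theorem level_returnMap_of_collides {q : P.Section} (hq : (P.rotate α q).Collides) :
    (P.returnMap α q).level = -(q.level + 1) := by
  change -(P.mirrorPassage (P.rotate α q)).level - 1 = _
  rw [mirrorPassage_of_collides hq]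
  exact (neg_add' q.level 1).symm

theorem level_returnMap_of_not_collides {q : P.Section} (hq : ¬(P.rotate α q).Collides) :
    (P.returnMap α q).level = q.level + 1 := by
  change -(P.mirrorPassage (P.rotate α q)).level - 1 = _
  rw [mirrorPassage_of_not_collides hq, neg_sub, sub_neg_eq_add, add_sub_cancel_left]
  rfl

theorem height_returnMap (q : P.Section) :
    (P.returnMap α q).height = wrap (P.halfWidth q.level) (q.height + α) := by
  change (P.mirrorPassage (P.rotate α q)).height = (P.rotate α q).height
  by_cases hq : (P.rotate α q).Collides
  · rw [mirrorPassage_of_collides hq]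
  · rw [mirrorPassage_of_not_collides hq]

theorem toPlane_returnMap (q : P.Section) :
    (P.returnMap α q).toPlane =
      P.glue (q.level + 1) (wrap (P.halfWidth q.level) (q.height + α)) := by
  set w := wrap (P.halfWidth q.level) (q.height + α) with hw
  have hcollides : (P.rotate α q).Collides ↔
      0 < q.level + 1 ∧ ¬(-P.p (q.level + 1).toNat ≤ w ∧ w < P.p (q.level + 1).toNat) := by
    rw [Int.lt_add_one_iff]
    refine and_congr_right fun (hk : 0 ≤ q.level) => not_congr ?_
    change w ∈ P.fiber (q.level + 1) ↔ _
    rw [fiber, halfWidth, if_pos (by omega), mem_Ico]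
  rw [Section.toPlane, height_returnMap, ← hw]
  by_cases hq : (P.rotate α q).Collides
  · rw [level_returnMap_of_collides hq, glue, if_pos (hcollides.1 hq), Int.cast_neg]
  · rw [level_returnMap_of_not_collides hq, glue, if_neg (mt hcollides.2 hq)]

theorem level_returnMap_eq_succ_iff {q : P.Section} (hq : 0 ≤ q.level) :
    (P.returnMap α q).level = q.level + 1 ↔ (P.returnMap α q).height ∈ P.fiber (q.level + 1) := by
  rw [height_returnMap]
  by_cases hcoll : (P.rotate α q).Collides
  · rw [level_returnMap_of_collides hcoll]
    exact iff_of_false (by omega) hcoll.2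
  · exact iff_of_true (level_returnMap_of_not_collides hcoll)
      (Section.height_mem_fiber_of_not_collides hcoll)

theorem level_returnMap_eq_succ_or_mem_verticalSides (q : P.Section) :
    (P.returnMap α q).level = q.level + 1 ∨ (P.returnMap α q).toPlane ∈ P.verticalSides := by
  by_cases hcoll : (P.rotate α q).Collides
  · obtain ⟨n, hn⟩ : ∃ n : ℕ, q.level = n := Int.eq_ofNat_of_zero_le hcoll.1
    refine Or.inr (Or.inr ⟨Section.toPlane_mem_surface _, n + 1, by omega, ?_, ?_⟩)
    · rw [Section.toPlane, level_returnMap_of_collides hcoll, hn]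
      push_cast
      rfl
    · rw [← fiber_natCast, Nat.cast_succ, ← hn]
      rw [Section.toPlane, height_returnMap]
      exact hcoll.2
  · exact Or.inl (level_returnMap_of_not_collides hcoll)

theorem notMem_verticalSides_of_pos {q : ℝ × ℝ} (hq : 0 < q.1) : q ∉ P.verticalSides := by
  rintro (⟨hq₀, -⟩ | ⟨-, k, -, hqk, -⟩)
  · linarith
  · linarith [k.cast_nonneg (α := ℝ)]

theorem level_returnMap_pow_of_notMem_verticalSides {q : P.Section} {d : ℕ}
    (hd : ∀ j < d, ((P.returnMap α ^ (j + 1)) q).toPlane ∉ P.verticalSides) {i : ℕ}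
    (hi : i ≤ d) : ((P.returnMap α ^ i) q).level = q.level + i := by
  induction i with
  | zero => simp
  | succ i ih =>
    have hside := hd i hi
    rw [pow_succ', Equiv.Perm.mul_apply] at hside ⊢
    rw [(level_returnMap_eq_succ_or_mem_verticalSides _).resolve_right hside, ih (by omega)]
    push_cast
    ring

theorem mem_directSet_iff {q : P.Section} {m d : ℕ} (hq : q.level = m) :
    q.height ∈ directSet P.p α m d ↔ ∀ i ≤ d, ((P.returnMap α ^ i) q).level = m + i := by
  have hmem : q.height ∈ Ico (-P.p m) (P.p m) := by
    simpa only [hq, fiber_natCast] using q.height_mem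
  induction d generalizing m q with
  | zero => simp [directSet, hmem, hq]
  | succ d ih =>
    have hheight : (P.returnMap α q).height = wrap (P.p m) (q.height + α) := by
      rw [height_returnMap, hq, halfWidth_natCast]
    have hlevel_iff : (P.returnMap α q).level = ((m + 1 : ℕ) : ℤ) ↔
        (P.returnMap α q).height ∈ Ico (-P.p (m + 1)) (P.p (m + 1)) := by
      have := level_returnMap_eq_succ_iff (α := α) (q := q) (by omega)
      rwa [hq, ← Nat.cast_succ, fiber_natCast] at this
    rw [directSet, mem_sep_iff, ← hheight, and_iff_right hmem]
    constructor
    · intro hdirect i hi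
      have hnext := hlevel_iff.2 (directSet_subset d hdirect)
      cases i with
      | zero => simpa using hq
      | succ i =>
        rw [pow_succ, Equiv.Perm.mul_apply,
          (ih hnext (directSet_subset d hdirect)).1 hdirect i (by omega)]
        push_cast
        ring
    · intro hlevel
      have hnext : (P.returnMap α q).level = ((m + 1 : ℕ) : ℤ) := by
        simpa using hlevel 1 (by omega)
      refine (ih hnext (hlevel_iff.1 hnext)).2 fun i hi => ?_
      have := hlevel (i + 1) (by omega)
      rw [pow_succ, Equiv.Perm.mul_apply] at this
      rw [this]
      push_cast
      ring

theorem mem_escapeHeights_iff {q : P.Section} {m : ℕ} (hq : q.level = m) :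
    q.height ∈ escapeHeights P.p α m ↔ ∀ i : ℕ, ((P.returnMap α ^ i) q).level = m + i := by
  simp only [escapeHeights, mem_ofPred_eq, mem_directSet_iff hq]
  exact ⟨fun hlevel i => hlevel i i le_rfl, fun hlevel _ i _ => hlevel i⟩

end ReturnMap

section Flow

variable {P : StepBilliard} {α : ℝ}

/-- The flow with slope `α` from a point of the cross section, as a function of the horizontal
distance `u` travelled (which counts the returns to the cross section) instead of time. -/
noncomputable def flow (P : StepBilliard) (α : ℝ) (q : P.Section) (u : ℝ) : ℝ × ℝ :=
  let r := (P.returnMap α ^ ⌊u⌋) q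
  (r.level + Int.fract u, wrap (P.halfWidth r.level) (r.height + Int.fract u * α))

theorem flow_add_intCast (q : P.Section) (u : ℝ) (n : ℤ) :
    P.flow α q (u + n) = P.flow α ((P.returnMap α ^ n) q) u := by
  simp only [flow, Int.floor_add_intCast, Int.fract_add_intCast, zpow_add, Equiv.Perm.mul_apply]

theorem flow_of_mem_Ico (q : P.Section) {u : ℝ} (hu : u ∈ Ico 0 1) :
    P.flow α q u = (q.level + u, wrap (P.halfWidth q.level) (q.height + u * α)) := by
  simp [flow, Int.floor_eq_zero_iff.2 hu, Int.fract_eq_self.2 hu]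

theorem flow_intCast (q : P.Section) (n : ℤ) :
    P.flow α q n = ((P.returnMap α ^ n) q).toPlane := by
  rw [← zero_add (n : ℝ), flow_add_intCast, flow_of_mem_Ico _ ⟨le_rfl, one_pos⟩, zero_mul,
    add_zero, add_zero, wrap_of_mem (Section.height_mem _), Section.toPlane]

theorem flow_natCast (q : P.Section) (n : ℕ) :
    P.flow α q n = ((P.returnMap α ^ n) q).toPlane :=
  flow_intCast q n

theorem range_flow_returnMap_zpow (q : P.Section) (n : ℤ) :
    range (P.flow α ((P.returnMap α ^ n) q)) = range (P.flow α q) := by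
  rw [← (Equiv.addRight (n : ℝ)).surjective.range_comp (P.flow α q)]
  exact congrArg range (funext fun u => (flow_add_intCast q u n).symm)

theorem flow_mem_surface (q : P.Section) (u : ℝ) : P.flow α q u ∈ P.surface := by
  simpa [surface, flow] using wrap_mem (halfWidth_pos _) _

theorem flow_add_of_lt (q : P.Section) {u v : ℝ} (hv : 0 ≤ v)
    (huv : (P.flow α q u).1 + v < ⌊(P.flow α q u).1⌋ + 1) :
    P.flow α q (u + v) = ((P.flow α q u).1 + v,
      wrap (P.halfWidth ⌊(P.flow α q u).1⌋) ((P.flow α q u).2 + v * α)) := by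
  rw [← Int.fract_add_floor u, add_right_comm, flow_add_intCast, flow_add_intCast] at *
  have hfract : Int.fract u ∈ Ico 0 1 := ⟨Int.fract_nonneg u, Int.fract_lt_one u⟩
  generalize (P.returnMap α ^ ⌊u⌋) q = r at *
  rw [flow_of_mem_Ico r hfract] at *
  have hfloor : ⌊(r.level : ℝ) + Int.fract u⌋ = r.level := by simp
  simp only [hfloor] at huv ⊢
  rw [flow_of_mem_Ico r ⟨by linarith [hfract.1], by linarith⟩, wrap_wrap_add (halfWidth_pos _),
    add_mul, add_assoc, add_assoc]

theorem flow_add_of_eq (q : P.Section) {u v : ℝ}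
    (huv : (P.flow α q u).1 + v = ⌊(P.flow α q u).1⌋ + 1) :
    P.flow α q (u + v) = P.glue (⌊(P.flow α q u).1⌋ + 1)
      (wrap (P.halfWidth ⌊(P.flow α q u).1⌋) ((P.flow α q u).2 + v * α)) := by
  rw [← Int.fract_add_floor u, add_right_comm, flow_add_intCast, flow_add_intCast] at *
  generalize (P.returnMap α ^ ⌊u⌋) q = r at *
  rw [flow_of_mem_Ico r ⟨Int.fract_nonneg u, Int.fract_lt_one u⟩] at *
  have hfloor : ⌊(r.level : ℝ) + Int.fract u⌋ = r.level := by simp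
  simp only [hfloor] at huv ⊢
  have hone : Int.fract u + v = 1 := by linarith
  rw [wrap_wrap_add (halfWidth_pos _), add_assoc, ← add_mul, hone, one_mul, ← toPlane_returnMap]
  simpa using flow_intCast r 1

theorem fract_flow_fst (q : P.Section) (u : ℝ) : Int.fract (P.flow α q u).1 = Int.fract u := by
  simp [flow]

theorem flow_add_of_flow_eq_toPlane {q r : P.Section} {u : ℝ} (hu : P.flow α r u = q.toPlane)
    (v : ℝ) : P.flow α r (u + v) = P.flow α q v := by
  have hfract : Int.fract u = 0 := by
    rw [← fract_flow_fst r, hu, Section.toPlane, Int.fract_intCast]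
  obtain ⟨n, rfl⟩ : ∃ n : ℤ, (n : ℝ) = u := Int.fract_eq_zero_iff.1 hfract
  rw [add_comm, flow_add_intCast, Section.toPlane_injective ((flow_intCast r n).symm.trans hu)]

theorem fst_flow_of_level_returnMap_pow {q : P.Section} {u : ℝ} (hu : 0 ≤ u)
    (hq : ((P.returnMap α ^ ⌊u⌋₊) q).level = q.level + ⌊u⌋₊) :
    (P.flow α q u).1 = q.level + u := by
  have hfloor : ⌊u⌋ = (⌊u⌋₊ : ℤ) := (Int.natCast_floor_eq_floor hu).symm
  rw [flow, hfloor, zpow_natCast, hq, ← hfloor, Int.cast_add, add_assoc, Int.floor_add_fract]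

end Flow

section Trajectory

variable {P : StepBilliard} {θ : ℝ} {γ : ℝ → ℝ × ℝ}

theorem isTrajectory_flow (hθ : 0 < Real.cos θ) (q : P.Section) :
    P.IsTrajectory θ fun t => P.flow (Real.tan θ) q (t * Real.cos θ) where
  mem_surface _ := flow_mem_surface q _
  inside t s hs hlt := by
    rw [add_mul, flow_add_of_lt q (mul_nonneg hs hθ.le) hlt, mul_assoc, mul_comm (Real.cos θ),
      Real.tan_mul_cos hθ.ne']
  crossing t s _ heq := by
    rw [add_mul, flow_add_of_eq q heq, mul_assoc, mul_comm (Real.cos θ),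
      Real.tan_mul_cos hθ.ne']

namespace IsTrajectory

theorem apply_add_div_cos_of_lt (hγ : P.IsTrajectory θ γ) (hθ : 0 < Real.cos θ) {t v : ℝ}
    (hv : 0 ≤ v) (hlt : (γ t).1 + v < ⌊(γ t).1⌋ + 1) :
    γ (t + v / Real.cos θ) =
      ((γ t).1 + v, wrap (P.halfWidth ⌊(γ t).1⌋) ((γ t).2 + v * Real.tan θ)) := by
  have hcancel := div_mul_cancel₀ v hθ.ne'
  rw [hγ.inside t (v / Real.cos θ) (by positivity) (by rwa [hcancel]), hcancel,
    div_mul_eq_mul_div, mul_div_assoc, ← Real.tan_eq_sin_div_cos]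

theorem apply_add_div_cos_of_eq (hγ : P.IsTrajectory θ γ) (hθ : 0 < Real.cos θ) {t v : ℝ}
    (hv : 0 ≤ v) (heq : (γ t).1 + v = ⌊(γ t).1⌋ + 1) :
    γ (t + v / Real.cos θ) =
      P.glue (⌊(γ t).1⌋ + 1) (wrap (P.halfWidth ⌊(γ t).1⌋) ((γ t).2 + v * Real.tan θ)) := by
  rw [hγ.crossing t (v / Real.cos θ) (by positivity) (by rwa [div_mul_cancel₀ v hθ.ne']),
    div_mul_eq_mul_div, mul_div_assoc, ← Real.tan_eq_sin_div_cos]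

theorem exists_toPlane (hγ : P.IsTrajectory θ γ) (hθ : 0 < Real.cos θ) (t : ℝ) :
    ∃ v ∈ Icc 0 1, ∃ q : P.Section, γ (t + v / Real.cos θ) = q.toPlane := by
  set v := 1 - Int.fract (γ t).1 with hv
  have hv₀ : 0 ≤ v := sub_nonneg.2 (Int.fract_lt_one _).le
  set w := wrap (P.halfWidth ⌊(γ t).1⌋) ((γ t).2 + v * Real.tan θ)
  have hw : w ∈ P.fiber ⌊(γ t).1⌋ := wrap_mem (halfWidth_pos _) _
  refine ⟨v, ⟨hv₀, sub_le_self 1 (Int.fract_nonneg _)⟩, P.returnMap 0 ⟨⌊(γ t).1⌋, w, hw⟩, ?_⟩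
  rw [toPlane_returnMap, add_zero, wrap_of_mem hw]
  exact hγ.apply_add_div_cos_of_eq hθ hv₀ (by rw [hv]; linarith [Int.fract_add_floor (γ t).1])

theorem apply_add_one_div_cos (hγ : P.IsTrajectory θ γ) (hθ : 0 < Real.cos θ) {t : ℝ}
    {q : P.Section} (hq : γ t = q.toPlane) :
    γ (t + 1 / Real.cos θ) = (P.returnMap (Real.tan θ) q).toPlane := by
  rw [hγ.apply_add_div_cos_of_eq hθ zero_le_one (by simp [hq, Section.toPlane]), one_mul, hq,
    toPlane_returnMap, Section.toPlane, Int.floor_intCast]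

theorem eq_flow_of_nonneg (hγ : P.IsTrajectory θ γ) (hθ : 0 < Real.cos θ) {t : ℝ}
    {q : P.Section} (hq : γ t = q.toPlane) {u : ℝ} (hu : 0 ≤ u) :
    γ (t + u / Real.cos θ) = P.flow (Real.tan θ) q u := by
  have hpow (n : ℕ) :
      γ (t + n / Real.cos θ) = ((P.returnMap (Real.tan θ) ^ n) q).toPlane := by
    induction n with
    | zero => simpa using hq
    | succ n ih =>
      rw [pow_succ', Equiv.Perm.mul_apply, ← hγ.apply_add_one_div_cos hθ ih, Nat.cast_succ,
        add_div, add_assoc]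
  have hfloor := hpow ⌊u⌋₊
  have hfract : u - ⌊u⌋₊ ∈ Ico (0 : ℝ) 1 :=
    ⟨by linarith [Nat.floor_le hu], by linarith [Nat.lt_floor_add_one u]⟩
  have hflow := flow_add_intCast (α := Real.tan θ) q (u - ⌊u⌋₊) ⌊u⌋₊
  rw [Int.cast_natCast, sub_add_cancel, zpow_natCast, flow_of_mem_Ico _ hfract] at hflow
  have hinside := hγ.apply_add_div_cos_of_lt hθ (t := t + ⌊u⌋₊ / Real.cos θ) hfract.1
    (by simp only [hfloor, Section.toPlane, Int.floor_intCast]; linarith [hfract.2])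
  rw [add_assoc, ← add_div, add_sub_cancel, hfloor] at hinside
  simpa only [hflow, Section.toPlane, Int.floor_intCast] using hinside

theorem eq_flow (hγ : P.IsTrajectory θ γ) (hθ : 0 < Real.cos θ) {t : ℝ} {q : P.Section}
    (hq : γ t = q.toPlane) (u : ℝ) : γ (t + u / Real.cos θ) = P.flow (Real.tan θ) q u := by
  obtain ⟨n, hn⟩ := exists_nat_ge (max 1 (1 - u))
  obtain ⟨hn₁, hnu⟩ := max_le_iff.1 hn
  obtain ⟨v, ⟨-, hv⟩, r, hr⟩ := hγ.exists_toPlane hθ (t - n / Real.cos θ)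
  have hflow {w : ℝ} (hw : 1 - n ≤ w) :
      γ (t + w / Real.cos θ) = P.flow (Real.tan θ) r (n - v + w) := by
    rw [← hγ.eq_flow_of_nonneg hθ hr (by linarith)]
    congr 1
    ring
  have hrq : P.flow (Real.tan θ) r (n - v) = q.toPlane := by
    rw [← hq]
    simpa using (hflow (w := 0) (by linarith)).symm
  rw [hflow (by linarith), flow_add_of_flow_eq_toPlane hrq]

theorem range_eq_range_flow (hγ : P.IsTrajectory θ γ) (hθ : 0 < Real.cos θ) {t : ℝ}
    {q : P.Section} (hq : γ t = q.toPlane) : range γ = range (P.flow (Real.tan θ) q) := by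
  have hsurj : Function.Surjective fun u : ℝ => t + u / Real.cos θ := fun s =>
    ⟨(s - t) * Real.cos θ, by simp only [mul_div_cancel_right₀ _ hθ.ne', add_sub_cancel]⟩
  rw [← hsurj.range_comp]
  exact congrArg range (funext fun u => hγ.eq_flow hθ hq u)

end IsTrajectory

end Trajectory

section Escape

variable {P : StepBilliard} {θ : ℝ}

theorem mem_directSet_of_mem_reachSet (hθ : 0 < Real.cos θ) {n : ℕ} {y : ℝ}
    (hy : y ∈ P.reachSet θ n) : y ∈ directSet P.p (Real.tan θ) 0 n := by
  obtain ⟨⟨-, hy₀⟩, γ, hγ, hγ₀, t, ht, ⟨hγt, -⟩, hside⟩ := hy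
  let q : P.Section := ⟨(0 : ℕ), y, by rwa [fiber_natCast]⟩
  have hflow (u : ℝ) : γ (u / Real.cos θ) = P.flow (Real.tan θ) q u := by
    rw [← zero_add (u / _), hγ.eq_flow hθ (q := q) (by simpa [q, Section.toPlane] using hγ₀)]
  have hu : 0 < t * Real.cos θ := mul_pos ht hθ
  have hlevel {i : ℕ} (hi : i ≤ ⌊t * Real.cos θ⌋₊) :
      ((P.returnMap (Real.tan θ) ^ i) q).level = q.level + i := by
    refine level_returnMap_pow_of_notMem_verticalSides (fun j hj => ?_) hi
    rw [← flow_natCast, ← hflow]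
    refine hside _ ⟨by positivity, ?_⟩
    rw [div_le_iff₀ hθ]
    exact (Nat.le_floor_iff hu.le).1 hj
  have htn : t * Real.cos θ = n := by
    rw [← hγt, ← mul_div_cancel_right₀ t hθ.ne', hflow, mul_div_cancel_right₀ _ hθ.ne',
      fst_flow_of_level_returnMap_pow hu.le (hlevel le_rfl)]
    simp [q]
  rw [htn, Nat.floor_natCast] at hlevel
  exact (mem_directSet_iff (q := q) rfl).2 fun i hi => hlevel hi

theorem mem_reachSet_of_mem_directSet (hθ : 0 < Real.cos θ) {n : ℕ} (hn : 1 ≤ n) {y : ℝ}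
    (hy : y ∈ directSet P.p (Real.tan θ) 0 n) : y ∈ P.reachSet θ n := by
  have hy₀ := directSet_subset n hy
  let q : P.Section := ⟨(0 : ℕ), y, by rwa [fiber_natCast]⟩
  have hlevel := (mem_directSet_iff (q := q) rfl).1 hy
  refine ⟨⟨rfl, hy₀⟩, _, isTrajectory_flow hθ q, ?_, n / Real.cos θ, by positivity, ?_,
    fun s hs => notMem_verticalSides_of_pos ?_⟩
  · simpa [q, Section.toPlane] using flow_natCast (α := Real.tan θ) q 0
  · have hheight := ((P.returnMap (Real.tan θ) ^ n) q).height_mem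
    rw [hlevel n le_rfl, Nat.cast_zero, zero_add, fiber_natCast] at hheight
    simp only [div_mul_cancel₀ _ hθ.ne', flow_natCast]
    exact ⟨by simp [Section.toPlane, hlevel n le_rfl], hheight⟩
  · have hs₀ : 0 < s * Real.cos θ := mul_pos hs.1 hθ
    have hsn : ⌊s * Real.cos θ⌋₊ ≤ n := Nat.floor_le_of_le ((le_div_iff₀ hθ).1 hs.2)
    rw [fst_flow_of_level_returnMap_pow hs₀.le (hlevel _ hsn)]
    simpa [q] using hs₀

theorem escapeSet_eq_escapeHeights (hθ : 0 < Real.cos θ) :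
    P.escapeSet θ = escapeHeights P.p (Real.tan θ) 0 := by
  ext y
  rw [escapeSet, mem_iInter₂]
  constructor
  · intro hy d
    exact antitone_directSet d.le_succ (mem_directSet_of_mem_reachSet hθ (hy _ d.succ_pos))
  · exact fun hy n hn => mem_reachSet_of_mem_directSet hθ hn (hy n)

theorem isEscapeOrbit_range_flow (hθ : 0 < Real.cos θ) {q : P.Section} {m : ℕ}
    (hq : q.level = m) (hesc : q.height ∈ escapeHeights P.p (Real.tan θ) m) :
    P.IsEscapeOrbit θ (range (P.flow (Real.tan θ) q)) := by
  have hlevel := (mem_escapeHeights_iff hq).1 hesc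
  have hfst {t : ℝ} (ht : 0 ≤ t) :
      (P.flow (Real.tan θ) q (t * Real.cos θ)).1 = m + t * Real.cos θ := by
    rw [fst_flow_of_level_returnMap_pow (by positivity) (hq ▸ hlevel _), hq, Int.cast_natCast]
  refine ⟨_, isTrajectory_flow hθ q, ?_, ⟨0, fun t ht => notMem_verticalSides_of_pos ?_⟩, ?_⟩
  · exact ((mul_right_surjective₀ hθ.ne').range_comp (P.flow (Real.tan θ) q)).symm
  · rw [hfst ht.le]
    positivity
  · refine (tendsto_atTop_add_const_left _ (m : ℝ) (tendsto_id.atTop_mul_const hθ)).congr' ?_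
    filter_upwards [eventually_ge_atTop 0] with t ht
    exact (hfst ht).symm

theorem IsEscapeOrbit.exists_eq_range_flow (hθ : 0 < Real.cos θ) {O : Set (ℝ × ℝ)}
    (hO : P.IsEscapeOrbit θ O) :
    ∃ m : ℕ, ∃ q : P.Section, q.level = m ∧ q.height ∈ escapeHeights P.p (Real.tan θ) m ∧
      O = range (P.flow (Real.tan θ) q) := by
  obtain ⟨γ, hγ, rfl, ⟨t₀, hside⟩, htendsto⟩ := hO
  obtain ⟨t₁, ht₁⟩ := eventually_atTop.1 (htendsto.eventually_ge_atTop 0)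
  set t := max t₀ t₁
  obtain ⟨v, ⟨hv, -⟩, q, hq⟩ := hγ.exists_toPlane hθ t
  have htv : t ≤ t + v / Real.cos θ := le_add_of_nonneg_right (by positivity)
  have hfst : (0 : ℝ) ≤ q.level := by
    simpa [hq, Section.toPlane] using ht₁ _ ((le_max_right t₀ t₁).trans htv)
  obtain ⟨m, hm⟩ := Int.eq_ofNat_of_zero_le (Int.cast_nonneg_iff.1 hfst)
  refine ⟨m, q, hm, (mem_escapeHeights_iff hm).2 fun i => ?_, hγ.range_eq_range_flow hθ hq⟩
  rw [← hm]
  refine level_returnMap_pow_of_notMem_verticalSides (fun j _ => ?_) le_rfl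
  rw [← flow_natCast, ← hγ.eq_flow hθ hq]
  exact hside _ (((le_max_left t₀ t₁).trans htv).trans_lt (lt_add_of_pos_right _ (by positivity)))

theorem existsUnique_isEscapeOrbit (hθ : 0 < Real.cos θ)
    (hencard : (escapeHeights P.p (Real.tan θ) 0).encard = 1) : ∃! O, P.IsEscapeOrbit θ O := by
  obtain ⟨y, hy⟩ := encard_eq_one.1 hencard
  have hy_mem : y ∈ escapeHeights P.p (Real.tan θ) 0 := hy ▸ mem_singleton y
  let q : P.Section := ⟨(0 : ℕ), y, by rw [fiber_natCast]; exact hy_mem 0⟩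
  refine ⟨_, isEscapeOrbit_range_flow hθ (q := q) rfl hy_mem, fun O hO => ?_⟩
  obtain ⟨m, r, hr, hr_mem, rfl⟩ := hO.exists_eq_range_flow hθ
  have hlevel := (mem_escapeHeights_iff (q := q) rfl).1 hy_mem
  set q' := (P.returnMap (Real.tan θ) ^ m) q with hq'
  have hq'_level : q'.level = m := by simpa using hlevel m
  have hq'_mem : q'.height ∈ escapeHeights P.p (Real.tan θ) m := by
    refine (mem_escapeHeights_iff hq'_level).2 fun i => ?_
    rw [hq', ← Equiv.Perm.mul_apply, ← pow_add, hlevel]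
    push_cast
    ring
  rw [← encard_escapeHeights P.p_pos P.p_antitone (m := m)] at hencard
  have hrq : r = q' := Section.ext (hr.trans hq'_level.symm)
    (encard_le_one_iff.1 hencard.le _ _ hr_mem hq'_mem)
  rw [hrq, hq', ← zpow_natCast, range_flow_returnMap_zpow]

end Escape

end StepBilliard

theorem mainTheorem3_general (P : StepBilliard) (lam : ℝ) (hlam : lam < (1 - Real.exp (-3)) / 3)
    (hP : ∀ n, P.p (n + 1) ≤ lam * P.p n) :
    ∀ᵐ θ ∂(volume.restrict (Ioo (-(Real.pi / 2)) (Real.pi / 2))),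
      (∃! O : Set (ℝ × ℝ), P.IsEscapeOrbit θ O) ∧ ∃! y : ℝ, y ∈ P.escapeSet θ := by
  filter_upwards [StepBilliard.ae_restrict_tan
      (StepBilliard.ae_encard_escapeHeights P.p_pos P.p_tendsto hlam hP),
    ae_restrict_mem measurableSet_Ioo] with θ hencard hθ
  have hcos := Real.cos_pos_of_mem_Ioo hθ
  refine ⟨StepBilliard.existsUnique_isEscapeOrbit hcos hencard, ?_⟩
  rw [StepBilliard.escapeSet_eq_escapeHeights hcos]
  obtain ⟨y, hy⟩ := encard_eq_one.1 hencard
  exact hy ▸ ⟨y, rfl, fun _ hz => hz⟩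

theorem sqrt_six_sub_one_div_five_lt : (√6 - 1) / 5 < (1 - Real.exp (-3)) / 3 := by
  have hsqrt : √6 < 2.45 := (Real.sqrt_lt' (by norm_num)).2 (by norm_num)
  have hexp : Real.exp (-3) ≤ 2 / 17 := by
    rw [Real.exp_neg, inv_le_comm₀ (Real.exp_pos 3) (by norm_num)]
    linarith [Real.quadratic_le_exp_of_nonneg (x := 3) (by norm_num)]
  linarith

theorem mainTheorem3 (P : StepBilliard) (lam : ℝ) (hlam_pos : 0 < lam)
    (hlam_lt : lam < (Real.sqrt 6 - 1) / 5) (hP : ∀ n : ℕ, P.p (n + 1) ≤ lam * P.p n) :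
    ∀ᵐ θ ∂(MeasureTheory.volume.restrict (Set.Ioo (0 : ℝ) (Real.pi / 2))),
      (∃! O : Set (ℝ × ℝ), P.IsEscapeOrbit θ O) ∧ (∃! y : ℝ, y ∈ P.escapeSet θ) :=
  ae_restrict_of_ae_restrict_of_subset (Ioo_subset_Ioo_left (by linarith [Real.pi_pos]))
    (mainTheorem3_general P lam (hlam_lt.trans sqrt_six_sub_one_div_five_lt) hP)
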